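/- Let $q$ be an odd prime power and let $n\ge 1$ be an odd integer. Let $L(x)=\sum_{i=0}^{n-1}a_ix^{q^i}$ and $\ell(x)=\sum_{i=0}^{n-1}b_ix^{q^i}$ be $q$-linear polynomials over $\mathbb F_{q^n}$, both of which are permutation polynomials of $\mathbb F_{q^n}$ (that is, they induce bijections of $\mathbb F_{q^n}$). Let $$L'(x)=\sum_{i=0}^{n-1}(a_ix)^{q^{n-i}},\qquad \ell'(x)=\sum_{i=0}^{n-1}(b_ix)^{q^{n-i}}$$ be their transposes, and put $$\operatorname{Tr}(x)=\sum_{i=0}^{n-1}x^{q^i},\qquad \lambda(x)=\sum_{i=0}^{n-1}(-1)^{i+1}x^{q^{2i}},\qquad s=\sum_{i=1}^{(n-1)/2}q^{2i}.$$ For $t\in\mathbb F_{q^n}^*$ let $M_t$ be the number of (distinct) $x\in\mathbb F_{q^n}^*$ such that $$\operatorname{Tr}\Big(\lambda\big(L'(x)^s\,\ell'(tx)^q\big)^{q+1}\Big)=0 .$$ Then $M_t$ is divisible by $q-1$ for every $t\in\mathbb F_{q^n}^*$, and the polynomial $\frac{L(x^{q+1})}{\ell(x)}$, meaning $L(x^{q+1})\,\ell(x)^{q^n-2}$,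 is a permutation polynomial of $\mathbb F_{q^n}$ if and only if $\frac{M_t}{q-1}$ is even for every $t\in\mathbb F_{q^n}^*$. -/

import Mathlib

open Polynomial

noncomputable section

namespace LinearizedQuotient

variable {F : Type*} [Field F]

/-- The `q`-linear (linearized) polynomial `L(x) = ∑_{i=0}^{n-1} a_i x^{q^i}` with coefficients
`a_0, …, a_{n-1}`. -/
def qLinear (q n : ℕ) (a : Fin n → F) : F[X] :=
  ∑ i : Fin n, C (a i) * X ^ q ^ (i : ℕ)

/-- The transpose `L'(x) = ∑_{i=0}^{n-1} (a_i x)^{q^{n-i}}` of the `q`-linear polynomial `L` with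
coefficients `a_0, …, a_{n-1}`. -/
def qTranspose (q n : ℕ) (a : Fin n → F) : F[X] :=
  ∑ i : Fin n, (C (a i) * X) ^ q ^ (n - (i : ℕ))

/-- `P` is a permutation polynomial of `F`: evaluation at `P` permutes `F`. -/
def IsPermPoly (P : F[X]) : Prop :=
  Function.Bijective fun x : F => P.eval x

/-- The polynomial `L(x^{q+1}) / ℓ(x)` over a field with `q ^ n` elements, where `1 / y` stands for
`y ^ (q ^ n - 2)`. -/
def quotientPoly (q n : ℕ) (a b : Fin n → F) : F[X] :=
  (qLinear q n a).comp (X ^ (q + 1)) * qLinear q n b ^ (q ^ n - 2)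

/-- `Tr(x) = ∑_{i=0}^{n-1} x^{q^i}`. -/
def qTrace (q n : ℕ) (x : F) : F :=
  ∑ i ∈ Finset.range n, x ^ q ^ i

/-- `λ(x) = ∑_{i=0}^{n-1} (-1)^{i+1} x^{q^{2i}}`. -/
def lam (q n : ℕ) (x : F) : F :=
  ∑ i ∈ Finset.range n, (-1) ^ (i + 1) * x ^ q ^ (2 * i)

/-- `s = ∑_{i=1}^{(n-1)/2} q^{2i}`. -/
def sExp (q n : ℕ) : ℕ :=
  ∑ i ∈ Finset.Icc 1 ((n - 1) / 2), q ^ (2 * i)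

/-- `M_t`: the number of (distinct) nonzero `x` in `F` with
`Tr(λ(L'(x)^s ℓ'(t x)^q)^{q+1}) = 0`. -/
def rootCount (q n : ℕ) (a b : Fin n → F) (t : F) : ℕ :=
  Set.ncard {x : F | x ≠ 0 ∧
    qTrace q n
      (lam q n ((qTranspose q n a).eval x ^ sExp q n * (qTranspose q n b).eval (t * x) ^ q)
        ^ (q + 1)) = 0}

end LinearizedQuotient

end

/-!
The quotient `L(x ^ (q + 1)) / ℓ(x)` maps nonzero elements to nonzero elements, and its preimages of
`t ≠ 0` are the nonzero zeros of `D(x) = L(x ^ (q + 1)) - t ℓ(x)`. Since `0` is a zero of `D` as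
well, the quotient is a permutation if and only if `D` has an even number of zeros for every `t ≠ 0`
(`isPermPoly_quotientPoly_iff`). It thus suffices to know the number of zeros of `D` modulo `2`.

Let `𝔽_q` be the subfield `{u | u ^ q = u}`. Counting the pairs `(x, y)` with `y ≠ 0` and
`Tr(y D(x)) = 0` by `x` and by `y`, and dividing by `q - 1`, expresses the number of zeros of `D`
through the numbers `Z_y` of `x` with `Tr(y D(x)) = 0`: as `n` is odd, `(q ^ n - 1) / (q - 1)` is odd
and `(q ^ (n - 1) - 1) / (q - 1)` is even, so the number of zeros of `D` has the parity of the number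
of classes of `y` modulo `𝔽_q`-scalars for which `Z_y` is odd (`even_card_odd_iff`).

Passing to transposes, `Z_y` is the number of points of the affine quadric
`Tr(A x ^ (q + 1)) = Tr(B x)` over `𝔽_q`, where `A = L'(y) ≠ 0` and `B = ℓ'(t y)`. This quadric has a
centre `x₀`, and the reflection `x ↦ 2 x₀ - x` maps it to itself and fixes only `x₀`; so `Z_y` is odd
if and only if the centre lies on the quadric, that is, `Tr(A x₀ ^ (q + 1)) = 0`
(`odd_card_quadric_iff`). The centre is the solution of `A ^ q x₀ ^ q² + A x₀ = B ^ q`. It is found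
explicitly by means of `λ`, and the condition becomes `Tr(λ(A ^ s B ^ q) ^ (q + 1)) = 0`, which is
the one counted by `M_t` (`exists_center`).
-/

namespace LinearizedQuotient

variable {F : Type*} [Field F]

/-! ### Frobenius, trace and transposes -/

/-- Raising to the power `q` is an iterate of the Frobenius endomorphism. -/
theorem exists_ringHom_eq_pow [Finite F] {q n : ℕ} (hq : IsPrimePow q) (hn : n ≠ 0)
    (hF : Nat.card F = q ^ n) : ∃ σ : F →+* F, ∀ x, σ x = x ^ q := by
  have := Fintype.ofFinite F
  obtain ⟨r, k, hr, hk, rfl⟩ := hq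
  have hr' := hr.nat_prime
  obtain ⟨p, hp⟩ := CharP.exists F
  obtain ⟨m, hpp, hm⟩ := FiniteField.card F p
  have hrp : r = p := by
    rw [← Nat.card_eq_fintype_card, hF] at hm
    refine (Nat.prime_dvd_prime_iff_eq hr' hpp).1 (hr'.dvd_of_dvd_pow (n := m) ?_)
    rw [← hm]
    exact dvd_pow (dvd_pow_self r hk.ne') hn
  subst hrp
  have : ExpChar F r := ExpChar.prime hr'
  exact ⟨iterateFrobenius F r k, fun x => iterateFrobenius_def ..⟩

section Frobenius

variable {q n : ℕ} {σ : F →+* F}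

theorem ringHom_pow_apply (hσ : ∀ x, σ x = x ^ q) (i : ℕ) (x : F) : (σ ^ i) x = x ^ q ^ i := by
  induction i with
  | zero => simp
  | succ i ih => rw [pow_succ', RingHom.mul_def, RingHom.comp_apply, ih, hσ, ← pow_mul, pow_succ]

theorem add_pow_frobenius (hσ : ∀ x, σ x = x ^ q) (i : ℕ) (x y : F) :
    (x + y) ^ q ^ i = x ^ q ^ i + y ^ q ^ i := by
  simp only [← ringHom_pow_apply hσ, map_add]

theorem sum_pow_frobenius (hσ : ∀ x, σ x = x ^ q) {ι : Type*} (s : Finset ι) (f : ι → F) (i : ℕ) :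
    (∑ j ∈ s, f j) ^ q ^ i = ∑ j ∈ s, f j ^ q ^ i := by
  simp only [← ringHom_pow_apply hσ, map_sum]

/-- The trace `qTrace q n`, as a homomorphism of additive groups. -/
def qTraceHom (hσ : ∀ x, σ x = x ^ q) (n : ℕ) : F →+ F where
  toFun := qTrace q n
  map_zero' := by simp [qTrace, ← ringHom_pow_apply hσ]
  map_add' x y := by simp only [qTrace, add_pow_frobenius hσ, Finset.sum_add_distrib]

@[simp]
theorem qTraceHom_apply (hσ : ∀ x, σ x = x ^ q) (x : F) : qTraceHom hσ n x = qTrace q n x := rfl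

theorem qTrace_zero (hσ : ∀ x, σ x = x ^ q) : qTrace q n (0 : F) = 0 := (qTraceHom hσ n).map_zero

theorem qTrace_add (hσ : ∀ x, σ x = x ^ q) (x y : F) :
    qTrace q n (x + y) = qTrace q n x + qTrace q n y := (qTraceHom hσ n).map_add x y

theorem qTrace_sub (hσ : ∀ x, σ x = x ^ q) (x y : F) :
    qTrace q n (x - y) = qTrace q n x - qTrace q n y := (qTraceHom hσ n).map_sub x y

theorem qTrace_sum (hσ : ∀ x, σ x = x ^ q) {ι : Type*} (s : Finset ι) (f : ι → F) :
    qTrace q n (∑ j ∈ s, f j) = ∑ j ∈ s, qTrace q n (f j) := map_sum (qTraceHom hσ n) f s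

theorem pow_pow_eq_self {u : F} (hu : u ^ q = u) (i : ℕ) : u ^ q ^ i = u := by
  induction i with
  | zero => simp
  | succ i ih => rw [pow_succ, pow_mul, ih, hu]

theorem qTrace_mul {u : F} (hu : u ^ q = u) (x : F) :
    qTrace q n (u * x) = u * qTrace q n x := by
  simp only [qTrace, mul_pow, pow_pow_eq_self hu, Finset.mul_sum]

theorem qTrace_pow (hn : ∀ x : F, x ^ q ^ n = x) (x : F) :
    qTrace q n (x ^ q) = qTrace q n x := by
  have h := (Finset.sum_range_succ (fun i => x ^ q ^ i) n).symm.trans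
    (Finset.sum_range_succ' (fun i => x ^ q ^ i) n)
  rw [hn, pow_zero, pow_one] at h
  simpa only [qTrace, ← pow_mul, ← pow_succ'] using (add_right_cancel h).symm

theorem qTrace_pow_pow (hn : ∀ x : F, x ^ q ^ n = x) (x : F) (i : ℕ) :
    qTrace q n (x ^ q ^ i) = qTrace q n x := by
  induction i with
  | zero => simp
  | succ i ih => rw [pow_succ, pow_mul, qTrace_pow hn, ih]

theorem qTrace_pow_eq_self (hσ : ∀ x, σ x = x ^ q) (hn : ∀ x : F, x ^ q ^ n = x) (x : F) :
    (qTrace q n x) ^ q = qTrace q n x := by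
  conv_rhs => rw [← qTrace_pow hn]
  have := sum_pow_frobenius hσ (Finset.range n) (fun i => x ^ q ^ i) 1
  rw [pow_one] at this
  simp only [qTrace, this, ← pow_mul, mul_comm]

theorem qLinear_eval (a : Fin n → F) (x : F) :
    (qLinear q n a).eval x = ∑ i : Fin n, a i * x ^ q ^ (i : ℕ) := by
  simp [qLinear, eval_finsetSum]

theorem qTranspose_eval (a : Fin n → F) (x : F) :
    (qTranspose q n a).eval x = ∑ i : Fin n, (a i * x) ^ q ^ (n - (i : ℕ)) := by
  simp [qTranspose, eval_finsetSum]

theorem qLinear_eval_zero (hσ : ∀ x, σ x = x ^ q) (a : Fin n → F) :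
    (qLinear q n a).eval 0 = 0 := by
  simp [qLinear_eval, ← ringHom_pow_apply hσ]

/-- The transpose is the adjoint for the trace form `(x, y) ↦ Tr(xy)`. -/
theorem qTrace_mul_qLinear (hσ : ∀ x, σ x = x ^ q) (hn : ∀ x : F, x ^ q ^ n = x)
    (a : Fin n → F) (x y : F) :
    qTrace q n (y * (qLinear q n a).eval x) = qTrace q n ((qTranspose q n a).eval y * x) := by
  rw [qLinear_eval, qTranspose_eval, Finset.mul_sum, Finset.sum_mul, qTrace_sum hσ, qTrace_sum hσ]
  refine Finset.sum_congr rfl fun i _ => ?_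
  rw [← qTrace_pow_pow hn (y * _) (n - i), ← mul_assoc, mul_pow, ← pow_mul, ← pow_add,
    Nat.add_sub_cancel' i.2.le, hn, mul_comm y]

/-- For odd `n`, the map `-λ/2` is a right inverse of `z ↦ z ^ q² + z`. -/
theorem lam_pow_add_lam (hσ : ∀ x, σ x = x ^ q) (hn : ∀ x : F, x ^ q ^ n = x) (hn_odd : Odd n)
    (x : F) : lam q n x ^ q ^ 2 + lam q n x = -2 * x := by
  have h := (Finset.sum_range_succ (fun i => (-1 : F) ^ (i + 1) * x ^ q ^ (2 * i)) n).symm.trans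
    (Finset.sum_range_succ' (fun i => (-1 : F) ^ (i + 1) * x ^ q ^ (2 * i)) n)
  have h1 : x ^ q ^ (2 * n) = x := by rw [two_mul, pow_add, pow_mul, hn, hn]
  have h2 : lam q n x ^ q ^ 2
      = -∑ i ∈ Finset.range n, (-1 : F) ^ (i + 1 + 1) * x ^ q ^ (2 * (i + 1)) := by
    rw [lam, sum_pow_frobenius hσ, ← Finset.sum_neg_distrib]
    refine Finset.sum_congr rfl fun i _ => ?_
    rw [mul_pow, ← pow_mul x, ← pow_add, ← ringHom_pow_apply hσ, map_pow, map_neg, map_one,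
      pow_succ _ (i + 1), mul_add]
    ring
  rw [h1, (hn_odd.add_one).neg_one_pow] at h
  simp only [Nat.mul_zero, pow_zero, pow_one, zero_add] at h
  rw [h2, lam]
  linear_combination h

/-! ### The centre of the quadric -/

theorem pow_sExp_pow_mul_pow {A : F} (hn : ∀ x : F, x ^ q ^ n = x) (hn_odd : Odd n) :
    (A ^ sExp q n) ^ q ^ 2 * A ^ q ^ 2 = A ^ sExp q n * A ^ q := by
  obtain ⟨m, rfl⟩ := hn_odd
  have hs : sExp q (2 * m + 1) * q ^ 2 + q ^ 2 = sExp q (2 * m + 1) + q ^ (2 * m + 1) * q := by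
    have hm : (2 * m + 1 - 1) / 2 = m := by omega
    simp only [sExp, hm]
    clear hm hn
    induction m with
    | zero => simp; ring
    | succ m ih =>
      rw [Finset.sum_Icc_succ_top (by omega), add_mul, add_right_comm, ih]
      ring
  rw [← pow_mul, ← pow_add, hs, pow_add, pow_mul A (q ^ _), hn]

/-- The centre of the quadric `Tr(A x ^ (q + 1)) = Tr(B x)` exists, and the vanishing there of the
quadratic form `Tr(A x ^ (q + 1))` is the condition that defines `rootCount`. -/
theorem exists_center (hσ : ∀ x, σ x = x ^ q) (hn : ∀ x : F, x ^ q ^ n = x) (hn_odd : Odd n)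
    (h2 : (2 : F) ≠ 0) {A : F} (hA : A ≠ 0) (B : F) :
    ∃ x₀ : F, A ^ q * x₀ ^ q ^ 2 + A * x₀ = B ^ q ∧
      (qTrace q n (A * x₀ ^ (q + 1)) = 0 ↔
        qTrace q n (lam q n (A ^ sExp q n * B ^ q) ^ (q + 1)) = 0) := by
  set w := A ^ sExp q n with hw
  have hw0 : w ≠ 0 := pow_ne_zero _ hA
  obtain ⟨v, hv⟩ : ∃ v : F, v ^ q = w :=
    ⟨w ^ q ^ (n - 1), by rw [← pow_mul, ← pow_succ, Nat.sub_add_cancel hn_odd.pos, hn]⟩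
  have hwv : A ^ q * w ^ q = A * v := by
    refine σ.injective ?_
    have := pow_sExp_pow_mul_pow (A := A) hn hn_odd
    rw [hσ, hσ, mul_pow, mul_pow, hv, ← pow_mul, ← pow_mul, ← pow_two, mul_comm, this, mul_comm]
  have hv0 : v ≠ 0 := by
    rintro rfl
    rw [mul_zero] at hwv
    exact mul_ne_zero (pow_ne_zero _ hA) (pow_ne_zero _ hw0) hwv
  -- `N` is the norm of `A`, the product of the `A ^ q ^ i`. Substituting `x₀ = v z` and multiplying
  -- by `w` turns the equation of the centre into `N (z ^ q² + z) = w B ^ q`, which `λ` solves.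
  set N := A * v * w with hN
  have hN0 : N ≠ 0 := mul_ne_zero (mul_ne_zero hA hv0) hw0
  have hNq : σ N = N := by
    rw [hσ, hN, mul_pow, mul_pow, hv]
    linear_combination w * hwv
  set c := -(2 * N)⁻¹ with hc
  have hcq : c ^ q = c := by rw [← hσ, hc, map_neg, map_inv₀, map_mul, hNq, map_ofNat]
  have hc0 : c ≠ 0 := neg_ne_zero.2 (inv_ne_zero (mul_ne_zero h2 hN0))
  set l := lam q n (w * B ^ q) with hl
  have hlam : l ^ q ^ 2 + l = -2 * (w * B ^ q) := lam_pow_add_lam hσ hn hn_odd _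
  refine ⟨v * (c * l), ?_, ?_⟩
  · have h1 : (v * (c * l)) ^ q ^ 2 = w ^ q * (c * l ^ q ^ 2) := by
      rw [mul_pow, mul_pow, pow_pow_eq_self hcq, pow_two q, pow_mul v, hv]
    have h3 : A * v * w * c * -2 = 1 := by rw [hc, ← hN]; field_simp
    rw [h1]
    linear_combination c * l ^ q ^ 2 * hwv + A * v * c * hlam + B ^ q * h3
  · have h1 : A * (v * (c * l)) ^ (q + 1) = N * c ^ 2 * l ^ (q + 1) := by
      rw [mul_pow, mul_pow, pow_succ v, pow_succ c, hv, hcq]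
      ring
    have h3 : (N * c ^ 2) ^ q = N * c ^ 2 := by
      rw [mul_pow, ← pow_mul, mul_comm 2 q, pow_mul, hcq, ← hσ, hNq]
    rw [h1, qTrace_mul h3, mul_eq_zero, or_iff_right (mul_ne_zero hN0 (pow_ne_zero _ hc0))]

/-- Reflection in the centre fixes only the centre, so the number of points of the quadric is odd
exactly when the centre lies on it. -/
theorem odd_card_quadric_iff [Fintype F] [DecidableEq F] (hσ : ∀ x, σ x = x ^ q)
    (hn : ∀ x : F, x ^ q ^ n = x) (hn_odd : Odd n) (h2 : (2 : F) ≠ 0) {A : F} (hA : A ≠ 0) (B : F) :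
    Odd (Finset.univ.filter fun x : F => qTrace q n (A * x ^ (q + 1) - B * x) = 0).card ↔
      qTrace q n (lam q n (A ^ sExp q n * B ^ q) ^ (q + 1)) = 0 := by
  obtain ⟨x₀, hx₀, hiff⟩ := exists_center hσ hn hn_odd h2 hA B
  rw [← hiff]
  set S := Finset.univ.filter fun x : F => qTrace q n (A * x ^ (q + 1) - B * x) = 0 with hS
  have hpolar (z : F) :
      qTrace q n (A * x₀ ^ q * z) + qTrace q n (A * x₀ * z ^ q) = qTrace q n (B * z) := by
    rw [← qTrace_pow hn (A * x₀ ^ q * z), ← qTrace_pow hn (B * z), ← qTrace_add hσ]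
    congr 1
    rw [mul_pow, mul_pow, mul_pow, ← hx₀, ← pow_mul, pow_two]
    ring
  -- Translated to the centre, the quadric is `Tr(A z ^ (q + 1)) = Tr(A x₀ ^ (q + 1))`.
  have hval (z : F) : qTrace q n (A * (x₀ + z) ^ (q + 1) - B * (x₀ + z))
      = qTrace q n (A * z ^ (q + 1)) - qTrace q n (A * x₀ ^ (q + 1)) := by
    have hexp : A * (x₀ + z) ^ (q + 1) - B * (x₀ + z) = A * x₀ ^ (q + 1) + A * z ^ (q + 1)
        + A * x₀ ^ q * z + A * x₀ * z ^ q - B * x₀ - B * z := by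
      rw [pow_succ, ← hσ, map_add, hσ, hσ]
      ring
    have h0 := hpolar x₀
    have hz := hpolar z
    rw [show A * x₀ ^ q * x₀ = A * x₀ ^ (q + 1) by ring,
      show A * x₀ * x₀ ^ q = A * x₀ ^ (q + 1) by ring] at h0
    rw [hexp, qTrace_sub hσ, qTrace_sub hσ, qTrace_add hσ, qTrace_add hσ, qTrace_add hσ]
    linear_combination hz + h0
  have hneg (z : F) : (-z) ^ (q + 1) = z ^ (q + 1) := by
    rw [pow_succ, pow_succ, ← hσ, ← hσ, map_neg, neg_mul_neg]
  have hmem (z : F) : x₀ + z ∈ S ↔ qTrace q n (A * z ^ (q + 1)) = qTrace q n (A * x₀ ^ (q + 1)) := by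
    rw [hS, Finset.mem_filter, and_iff_right (Finset.mem_univ _), hval, sub_eq_zero]
  have heven : Even (S.erase x₀).card := by
    rw [← ZMod.natCast_eq_zero_iff_even, Finset.cast_card]
    refine Finset.sum_involution (fun x _ => x₀ + -(x - x₀)) (fun _ _ => by decide) ?_ ?_ ?_
    · intro x hx _ h
      refine Finset.ne_of_mem_erase hx ?_
      have : (2 : F) * (x - x₀) = 0 := by linear_combination -h
      exact sub_eq_zero.1 ((mul_eq_zero.1 this).resolve_left h2)
    · intro x hx
      rw [Finset.mem_erase] at hx ⊢
      refine ⟨fun h => hx.1 (by linear_combination -h), ?_⟩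
      rw [hmem, hneg, ← hmem, add_sub_cancel]
      exact hx.2
    · intro x _
      ring
  have h0 : x₀ ∈ S ↔ qTrace q n (A * x₀ ^ (q + 1)) = 0 := by
    have := hmem 0
    rw [add_zero, zero_pow q.succ_ne_zero, mul_zero, qTrace_zero hσ] at this
    rw [this, eq_comm]
  rw [← h0]
  by_cases h : x₀ ∈ S
  · rw [← Finset.card_erase_add_one h]
    exact iff_of_true heven.add_one h
  · rw [Finset.erase_eq_of_notMem h] at heven
    exact iff_of_false (Nat.not_odd_iff_even.2 heven) h

/-! ### Counting modulo 2 -/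

theorem card_qTrace_eq_zero_le [Fintype F] [DecidableEq F] (hq : 1 < q) (hn : n ≠ 0) :
    (Finset.univ.filter fun x : F => qTrace q n x = 0).card ≤ q ^ (n - 1) := by
  obtain ⟨m, rfl⟩ := Nat.exists_eq_succ_of_ne_zero hn
  rw [Nat.succ_sub_one]
  set P : F[X] := ∑ i ∈ Finset.range (m + 1), X ^ q ^ i with hP
  have hdeg : P.natDegree ≤ q ^ m := by
    refine natDegree_sum_le_of_forall_le _ _ fun i hi => ?_
    rw [natDegree_X_pow]
    exact Nat.pow_le_pow_right hq.le (Nat.lt_succ_iff.1 (Finset.mem_range.1 hi))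
  have hcoeff : P.coeff (q ^ m) = 1 := by
    rw [hP, finsetSum_coeff, Finset.sum_eq_single m]
    · simp
    · intro i _ hi
      rw [coeff_X_pow, if_neg fun h => hi (Nat.pow_right_injective hq h).symm]
    · simp
  have hP0 : P ≠ 0 := by
    intro h
    simp [h] at hcoeff
  refine (card_le_degree_of_subset_roots (p := P) fun x hx => ?_).trans hdeg
  rw [mem_roots hP0, IsRoot, hP, eval_finsetSum]
  simpa [qTrace] using (Finset.mem_filter.1 hx).2

theorem card_qTrace_eq_zero [Fintype F] [DecidableEq F] (hσ : ∀ x, σ x = x ^ q)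
    (hn : ∀ x : F, x ^ q ^ n = x) (hq : 1 < q) (hn0 : n ≠ 0) (hF : Fintype.card F = q ^ n) :
    (Finset.univ.filter fun x : F => qTrace q n x = 0).card = q ^ (n - 1) := by
  -- The bound on the kernel is sharp because the image lies among the `q` roots of `X ^ q - X`.
  refine (card_qTrace_eq_zero_le hq hn0).antisymm ?_
  have hker : Nat.card (qTraceHom hσ n).ker
      = (Finset.univ.filter fun x : F => qTrace q n x = 0).card := by
    rw [← Nat.card_eq_finsetCard]
    exact Nat.card_congr (Equiv.subtypeEquivRight fun x => by simp [AddMonoidHom.mem_ker])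
  have hrange : Nat.card (qTraceHom hσ n).range ≤ q := by
    have h0 := FiniteField.X_pow_card_sub_X_ne_zero F hq
    refine le_trans ?_ ((card_le_degree_of_subset_roots (Z := (X ^ q - X : F[X]).roots.toFinset)
      fun x hx => Multiset.mem_toFinset.1 hx).trans_eq
      (FiniteField.X_pow_card_sub_X_natDegree_eq F hq))
    rw [← Nat.card_eq_finsetCard]
    refine Nat.card_mono (Finset.finite_toSet _) ?_
    rintro _ ⟨x, rfl⟩
    simpa [h0, sub_eq_zero] using qTrace_pow_eq_self hσ hn x
  have hmul := (qTraceHom hσ n).ker.card_mul_index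
  rw [AddSubgroup.index_ker, hker, Nat.card_eq_fintype_card (α := F), hF] at hmul
  obtain ⟨m, rfl⟩ := Nat.exists_eq_succ_of_ne_zero hn0
  rw [Nat.succ_sub_one]
  refine Nat.le_of_mul_le_mul_right ?_ (zero_lt_one.trans hq)
  rw [← pow_succ, ← hmul]
  exact Nat.mul_le_mul_left _ hrange

end Frobenius

/-- The group of `(q - 1)`-th roots of unity acts freely on `Fˣ`, with orbits on which `g` is
constant. -/
theorem dvd_sum_of_smul_invariant [Fintype F] [DecidableEq F] {q n : ℕ} (hq : 1 < q) (hn : n ≠ 0)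
    (hF : Fintype.card F = q ^ n) (g : F → ℕ) (hg : ∀ u y : F, u ≠ 0 → u ^ q = u → g (u * y) = g y) :
    q - 1 ∣ ∑ y ∈ Finset.univ.filter (fun y : F => y ≠ 0), g y := by
  obtain ⟨ζ, hζ⟩ := IsCyclic.exists_generator (α := Fˣ)
  have hord : orderOf ζ = q ^ n - 1 := by
    rw [orderOf_eq_card_of_forall_mem_zpowers hζ, Nat.card_eq_fintype_card, Fintype.card_units, hF]
  have hdvd : q - 1 ∣ q ^ n - 1 := by simpa using Nat.sub_dvd_pow_sub_pow q 1 n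
  obtain ⟨d, hd⟩ := hdvd
  have hpos : q ^ n - 1 ≠ 0 := (Nat.sub_pos_of_lt (Nat.one_lt_pow hn hq)).ne'
  have hd0 : d ≠ 0 := by
    rintro rfl
    exact hpos hd
  set H := Subgroup.zpowers (ζ ^ d) with hH
  have hcard : Nat.card H = q - 1 := by
    rw [Nat.card_zpowers, orderOf_pow_of_dvd hd0 (hord ▸ hd ▸ dvd_mul_left d _), hord, hd,
      Nat.mul_div_cancel _ (Nat.pos_of_ne_zero hd0)]
  have hfix (u : H) : ((u : Fˣ) : F) ^ q = (u : Fˣ) := by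
    have h : (u : Fˣ) ^ (q - 1) = 1 := by
      have := pow_card_eq_one' (x := u)
      rw [hcard] at this
      exact_mod_cast congrArg Subtype.val this
    rw [← Nat.sub_add_cancel hq.le, pow_succ, ← Units.val_pow_eq_pow_val, h, Units.val_one, one_mul]
  have hsum : ∑ y ∈ Finset.univ.filter (fun y : F => y ≠ 0), g y = ∑ y : Fˣ, g y := by
    refine (Finset.sum_bij (fun (y : Fˣ) _ => (y : F)) ?_ ?_ ?_ fun _ _ => rfl).symm
    · simp
    · exact fun y _ z _ h => Units.ext h
    · exact fun y hy => ⟨Units.mk0 y (Finset.mem_filter.1 hy).2, Finset.mem_univ _, rfl⟩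
  classical
  have := Fintype.ofFinite (Fˣ ⧸ H)
  rw [hsum, ← Finset.sum_fiberwise Finset.univ (fun y : Fˣ => (y : Fˣ ⧸ H))]
  refine Finset.dvd_sum fun c _ => ?_
  obtain ⟨z, rfl⟩ := QuotientGroup.mk_surjective c
  have hconst : ∑ y ∈ Finset.univ.filter (fun y : Fˣ => (y : Fˣ ⧸ H) = z), g y
      = ∑ h : H, g z := by
    symm
    refine Finset.sum_bij (fun (h : H) _ => (h : Fˣ) * z) ?_ ?_ ?_ ?_
    · intro h _
      rw [Finset.mem_filter, mul_comm]
      exact ⟨Finset.mem_univ _, QuotientGroup.mk_mul_of_mem z h.2⟩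
    · exact fun h _ h' _ e => Subtype.ext (mul_right_cancel e)
    · intro y hy
      refine ⟨⟨z⁻¹ * y, QuotientGroup.eq.1 (Finset.mem_filter.1 hy).2.symm⟩, Finset.mem_univ _, ?_⟩
      rw [mul_comm, mul_inv_cancel_left]
    · intro h _
      rw [Units.val_mul, hg _ _ (Units.ne_zero _) (hfix h)]
  rw [hconst, Finset.sum_const, Finset.card_univ, ← Nat.card_eq_fintype_card, hcard, smul_eq_mul]
  exact dvd_mul_right _ _

section Frobenius

variable {q n : ℕ} {σ : F →+* F}

/-- Counting the pairs `(x, y)` with `y ≠ 0` and `Tr(y D(x)) = 0` in two ways. -/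
theorem sum_card_qTrace_mul_eq_zero [Fintype F] [DecidableEq F] (hσ : ∀ x, σ x = x ^ q)
    (hn : ∀ x : F, x ^ q ^ n = x) (hq : 1 < q) (hn0 : n ≠ 0) (hF : Fintype.card F = q ^ n)
    (D : F → F) :
    ∑ y ∈ Finset.univ.filter (fun y : F => y ≠ 0),
        (Finset.univ.filter fun x => qTrace q n (y * D x) = 0).card
      = (Finset.univ.filter fun x => D x = 0).card * (q ^ n - 1)
        + (Finset.univ.filter fun x => D x ≠ 0).card * (q ^ (n - 1) - 1) := by
  have hker (d : F) : ((Finset.univ.filter fun y : F => y ≠ 0).filter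
      fun y => qTrace q n (y * d) = 0).card = if d = 0 then q ^ n - 1 else q ^ (n - 1) - 1 := by
    split_ifs with hd
    · subst hd
      simp [qTrace_zero hσ, Finset.filter_ne', hF]
    · rw [← card_qTrace_eq_zero hσ hn hq hn0 hF, ← Finset.card_erase_of_mem (a := (0 : F))
        (by simp [qTrace_zero hσ])]
      refine Finset.card_bij (fun y _ => y * d) ?_ ?_ ?_
      · simp +contextual [hd]
      · intro x _ y _ h
        exact mul_right_cancel₀ hd h
      · intro y hy
        refine ⟨y / d, ?_, div_mul_cancel₀ y hd⟩
        simpa [hd] using hy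
  simp only [Finset.card_filter (fun x => qTrace q n (_ * D x) = 0)]
  rw [Finset.sum_comm]
  simp only [← Finset.card_filter, hker]
  rw [Finset.sum_ite, Finset.sum_const, Finset.sum_const, smul_eq_mul, smul_eq_mul]

/-- Modulo `2`, the number of zeros of an arbitrary map `D` is the number of points `y` of the
projective space of `F` over the subfield with `q` elements for which `Tr(y D(x))` has an odd
number of zeros `x`. -/
theorem even_card_odd_iff [Fintype F] [DecidableEq F] (hσ : ∀ x, σ x = x ^ q)
    (hn : ∀ x : F, x ^ q ^ n = x) (hq : 1 < q) (hq_odd : Odd q) (hn_odd : Odd n)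
    (hF : Fintype.card F = q ^ n) (D : F → F) (M : ℕ)
    (hM : M = (Finset.univ.filter fun y : F => y ≠ 0 ∧
      Odd (Finset.univ.filter fun x => qTrace q n (y * D x) = 0).card).card) :
    q - 1 ∣ M ∧ (Even (M / (q - 1)) ↔ Even (Finset.univ.filter fun x => D x = 0).card) := by
  have hn0 := hn_odd.pos.ne'
  set Z : F → ℕ := fun y => (Finset.univ.filter fun x => qTrace q n (y * D x) = 0).card with hZ
  have hinv (u y : F) (hu0 : u ≠ 0) (hu : u ^ q = u) : Z (u * y) = Z y := by
    simp only [hZ, mul_assoc, qTrace_mul hu, mul_eq_zero, hu0, false_or]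
  have hM' : M = ∑ y ∈ Finset.univ.filter (fun y : F => y ≠ 0), Z y % 2 := by
    rw [hM, ← Finset.filter_filter, Finset.card_filter]
    refine Finset.sum_congr rfl fun y _ => ?_
    split_ifs with h
    · exact (Nat.odd_iff.1 h).symm
    · exact (Nat.even_iff.1 (Nat.not_odd_iff_even.1 h)).symm
  obtain ⟨k, hk⟩ : q - 1 ∣ M := hM' ▸ dvd_sum_of_smul_invariant hq hn0 hF (fun y => Z y % 2)
    fun u y hu0 hu => by rw [hinv u y hu0 hu]
  obtain ⟨j, hj⟩ := dvd_sum_of_smul_invariant hq hn0 hF (fun y => Z y / 2)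
    fun u y hu0 hu => by rw [hinv u y hu0 hu]
  have hq0 : 0 < q - 1 := Nat.sub_pos_of_lt hq
  have hgeom (m : ℕ) : q ^ m - 1 = (q - 1) * ∑ i ∈ Finset.range m, q ^ i := by
    rw [mul_comm, Nat.geomSum_eq hq, Nat.div_mul_cancel (by simpa using Nat.sub_dvd_pow_sub_pow q 1 m)]
  have hparity (m : ℕ) : Odd (∑ i ∈ Finset.range m, q ^ i) ↔ Odd m := by
    rw [Finset.odd_sum_iff_odd_card_odd, Finset.filter_true_of_mem fun i _ => hq_odd.pow,
      Finset.card_range]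
  have hsum := sum_card_qTrace_mul_eq_zero hσ hn hq hn0 hF D
  have hsplit : ∑ y ∈ Finset.univ.filter (fun y : F => y ≠ 0), Z y
      = (q - 1) * (k + 2 * j) := by
    rw [mul_add, ← hk, mul_left_comm, ← hj, hM', Finset.mul_sum, ← Finset.sum_add_distrib]
    exact Finset.sum_congr rfl fun y _ => (Nat.mod_add_div _ _).symm
  rw [hsplit, hgeom, hgeom, mul_left_comm, mul_left_comm _ (q - 1), ← mul_add] at hsum
  have hsum' := Nat.eq_of_mul_eq_mul_left hq0 hsum
  refine ⟨⟨k, hk⟩, ?_⟩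
  rw [hk, Nat.mul_div_cancel_left _ hq0]
  have h1 := (hparity n).2 hn_odd
  have h2 : Even (∑ i ∈ Finset.range (n - 1), q ^ i) := by
    rw [← Nat.not_odd_iff_even, hparity, Nat.not_odd_iff_even]
    exact Nat.Odd.sub_odd hn_odd odd_one
  have h3 := congrArg Even hsum'
  simpa [Nat.even_add, Nat.even_mul, h2, Nat.not_even_iff_odd.2 h1] using h3

theorem qTranspose_eval_ne_zero [Fintype F] [DecidableEq F] (hσ : ∀ x, σ x = x ^ q)
    (hn : ∀ x : F, x ^ q ^ n = x) (hq : 1 < q) (hn0 : n ≠ 0) (hF : Fintype.card F = q ^ n)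
    (a : Fin n → F) (hL : IsPermPoly (qLinear q n a)) {y : F} (hy : y ≠ 0) :
    (qTranspose q n a).eval y ≠ 0 := by
  intro h
  have hall (x : F) : qTrace q n x = 0 := by
    obtain ⟨z, hz⟩ := hL.2 (x / y)
    have hz' : y * (qLinear q n a).eval z = x := by
      rw [show (qLinear q n a).eval z = x / y from hz, mul_div_cancel₀ x hy]
    rw [← hz', qTrace_mul_qLinear hσ hn, h, zero_mul, qTrace_zero hσ]
  have hcard := card_qTrace_eq_zero (σ := σ) hσ hn hq hn0 hF
  rw [Finset.filter_true_of_mem fun x _ => hall x, Finset.card_univ, hF] at hcard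
  exact hn0 (by have := Nat.pow_right_injective hq hcard; omega)

/-! ### The permutation criterion -/

/-- The quotient takes a value `t ≠ 0` exactly at the nonzero roots of `L(x ^ (q + 1)) - t ℓ(x)`.
A permutation gives each of these polynomials two roots, one of them `0`; conversely, an even number
of roots leaves a nonzero one, so that the quotient is onto. -/
theorem isPermPoly_quotientPoly_iff [Fintype F] [DecidableEq F] (hσ : ∀ x, σ x = x ^ q)
    (hF : Fintype.card F = q ^ n) (hcard : 2 < q ^ n)
    (a b : Fin n → F) (hl : IsPermPoly (qLinear q n b)) :
    IsPermPoly (quotientPoly q n a b) ↔ ∀ t : F, t ≠ 0 → Even (Finset.univ.filter fun x =>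
      (qLinear q n a).eval (x ^ (q + 1)) - t * (qLinear q n b).eval x = 0).card := by
  have hfin : Finite F := inferInstance
  have heval (x : F) : (quotientPoly q n a b).eval x
      = (qLinear q n a).eval (x ^ (q + 1)) * (qLinear q n b).eval x ^ (q ^ n - 2) := by
    simp [quotientPoly]
  have hL0 : (qLinear q n a).eval 0 = 0 := qLinear_eval_zero hσ a
  have hl0 : (qLinear q n b).eval 0 = 0 := qLinear_eval_zero hσ b
  have hzero : (quotientPoly q n a b).eval 0 = 0 := by
    rw [heval, hl0, zero_pow (Nat.sub_pos_of_lt hcard).ne', mul_zero]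
  have hlne {x : F} (hx : x ≠ 0) : (qLinear q n b).eval x ≠ 0 := fun h =>
    hx (hl.1 (h.trans hl0.symm))
  have hiff {x : F} (hx : x ≠ 0) (t : F) : (quotientPoly q n a b).eval x = t ↔
      (qLinear q n a).eval (x ^ (q + 1)) - t * (qLinear q n b).eval x = 0 := by
    have hinv : (qLinear q n b).eval x ^ (q ^ n - 2) = ((qLinear q n b).eval x)⁻¹ := by
      refine eq_inv_of_mul_eq_one_left ?_
      rw [← pow_succ, show q ^ n - 2 + 1 = q ^ n - 1 by omega, ← hF,
        FiniteField.pow_card_sub_one_eq_one _ (hlne hx)]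
    rw [heval, hinv, ← div_eq_mul_inv, div_eq_iff (hlne hx), sub_eq_zero]
  set S : F → Finset F := fun t => Finset.univ.filter fun x =>
    (qLinear q n a).eval (x ^ (q + 1)) - t * (qLinear q n b).eval x = 0 with hS
  have h0S (t : F) : 0 ∈ S t := by simp [hS, hL0, hl0]
  have hmem {t x : F} (hx : x ≠ 0) : x ∈ S t ↔ (quotientPoly q n a b).eval x = t := by
    simp [hS, hiff hx]
  constructor
  · intro hbij t ht
    obtain ⟨x, hx⟩ := hbij.2 t
    have hx0 : x ≠ 0 := by
      rintro rfl
      exact ht (hx.symm.trans hzero)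
    suffices h : S t = {0, x} by
      change Even (S t).card
      rw [h, Finset.card_pair hx0.symm]
      exact even_two
    ext y
    rw [Finset.mem_insert, Finset.mem_singleton]
    by_cases hy : y = 0
    · exact iff_of_true (hy ▸ h0S t) (Or.inl hy)
    · rw [hmem hy, or_iff_right hy]
      exact ⟨fun h => hbij.1 (h.trans hx.symm), fun h => h ▸ hx⟩
  · intro heven
    refine Function.Surjective.bijective_of_finite fun t => ?_
    by_cases ht : t = 0
    · exact ⟨0, hzero.trans ht.symm⟩
    -- The root `0` cannot be the only element of a set of even size.
    have hone : 1 < (S t).card := by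
      have hpos := Finset.card_pos.2 ⟨0, h0S t⟩
      obtain ⟨k, hk⟩ : Even (S t).card := heven t ht
      omega
    obtain ⟨x, hxS, hx⟩ := Finset.exists_mem_ne hone 0
    exact ⟨x, (hmem hx).1 hxS⟩

end Frobenius

end LinearizedQuotient

theorem mainTheorem6 {F : Type*} [Field F] [Finite F] (q n : ℕ)
    (hq : IsPrimePow q) (hq_odd : Odd q) (hn_odd : Odd n) (hF : Nat.card F = q ^ n)
    (a b : Fin n → F)
    (hL : LinearizedQuotient.IsPermPoly (LinearizedQuotient.qLinear q n a))
    (hl : LinearizedQuotient.IsPermPoly (LinearizedQuotient.qLinear q n b)) :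
    (∀ t : F, t ≠ 0 → (q - 1) ∣ LinearizedQuotient.rootCount q n a b t) ∧
    (LinearizedQuotient.IsPermPoly (LinearizedQuotient.quotientPoly q n a b) ↔
      ∀ t : F, t ≠ 0 → Even (LinearizedQuotient.rootCount q n a b t / (q - 1))) := by
  classical
  have := Fintype.ofFinite F
  rw [Nat.card_eq_fintype_card] at hF
  have hn0 := hn_odd.pos.ne'
  have hq1 := hq.one_lt
  obtain ⟨σ, hσ⟩ := LinearizedQuotient.exists_ringHom_eq_pow hq hn0
    (Nat.card_eq_fintype_card.trans hF)
  have hn (x : F) : x ^ q ^ n = x := by rw [← hF, FiniteField.pow_card]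
  have h2 : (2 : F) ≠ 0 := by
    refine Ring.two_ne_zero fun h => ?_
    have := FiniteField.even_card_of_char_two h
    rw [hF] at this
    exact Nat.not_odd_iff.2 this hq_odd.pow
  have hcard : 2 < q ^ n := by
    have := Nat.one_lt_pow hn0 hq1
    obtain ⟨k, hk⟩ := hq_odd.pow (n := n)
    omega
  have key (t : F) := LinearizedQuotient.even_card_odd_iff hσ hn hq1 hq_odd hn_odd hF
    (fun x => (LinearizedQuotient.qLinear q n a).eval (x ^ (q + 1))
      - t * (LinearizedQuotient.qLinear q n b).eval x)
    (LinearizedQuotient.rootCount q n a b t) (by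
      rw [LinearizedQuotient.rootCount, ← Set.ncard_coe_finset]
      congr 1
      ext y
      simp only [Set.mem_ofPred_eq, Finset.coe_filter, Finset.mem_univ, true_and]
      refine and_congr_right fun hy => ?_
      have hA := LinearizedQuotient.qTranspose_eval_ne_zero hσ hn hq1 hn0 hF a hL hy
      rw [← LinearizedQuotient.odd_card_quadric_iff hσ hn hn_odd h2 hA]
      -- By adjunction, `Tr(y (L(x ^ (q + 1)) - t ℓ(x))) = Tr(L'(y) x ^ (q + 1) - ℓ'(t y) x)`.
      simp only [mul_sub, LinearizedQuotient.qTrace_sub hσ, ← mul_assoc,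
        LinearizedQuotient.qTrace_mul_qLinear hσ hn, mul_comm t y])
  refine ⟨fun t _ => (key t).1, ?_⟩
  rw [LinearizedQuotient.isPermPoly_quotientPoly_iff hσ hF hcard a b hl]
  exact forall₂_congr fun t _ => (key t).2.symm
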